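/- Let $A$ be a unital C*-algebra which is simple (that is, $A \neq 0$ and $A$ has no closed two-sided ideals other than $0$ and $A$) and purely infinite (that is, every nonzero hereditary C*-subalgebra of $A$ contains an infinite projection: a projection $p$ for which there is $v \in A$ with $v^* v = p$, $v v^* \leq p$ and $v v^* \neq p$). Let $V : A \to A$ be a unital completely positive map which is nuclear, that is, $V$ is a pointwise norm limit of maps of the form $T \circ S$ with $n \in \mathbb{N}$ and $S : A \to M_n(\mathbb{C})$, $T : M_n(\mathbb{C}) \to A$ unital and completely positive. Then for every $\varepsilon > 0$ and every finite subset $F \subset A$ there exists a nonunitary isometry $s \in A$ (that is, $s^* s = 1$ and $s s^* \neq 1$) such that $\| s^* a s - V(a) \| < \varepsilon$ for all $a \in F$. -/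

import Mathlib

open scoped CStarAlgebra ComplexOrder

/-- A unital C⋆-algebra is simple if it is nonzero and its only closed two-sided ideals are
`0` and the whole algebra. -/
structure CStarIsSimple (A : Type*) [CStarAlgebra A] : Prop where
  nontrivial : Nontrivial A
  eq_bot_or_eq_top : ∀ I : TwoSidedIdeal A, IsClosed (I : Set A) → I = ⊥ ∨ I = ⊤

/-- A projection is infinite if it is Murray-von Neumann equivalent to a proper subprojection
of itself. -/
def IsInfiniteProjection {A : Type*} [CStarAlgebra A] [PartialOrder A] [StarOrderedRing A]
    (p : A) : Prop :=
  IsStarProjection p ∧ ∃ v : A, star v * v = p ∧ v * star v ≤ p ∧ v * star v ≠ p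

/-- A C⋆-subalgebra (closed star subalgebra, not necessarily unital) `B` of `A` is hereditary if
`0 ≤ a ≤ b` with `b ∈ B` implies `a ∈ B`. -/
structure IsHereditaryCStarSubalgebra {A : Type*} [CStarAlgebra A] [PartialOrder A]
    [StarOrderedRing A] (B : NonUnitalStarSubalgebra ℂ A) : Prop where
  isClosed : IsClosed (B : Set A)
  mem_of_le : ∀ b ∈ B, ∀ a : A, 0 ≤ a → a ≤ b → a ∈ B

/-- A unital simple C⋆-algebra is purely infinite if every nonzero hereditary C⋆-subalgebra
contains an infinite projection. -/
structure IsPurelyInfiniteSimple (A : Type*) [CStarAlgebra A] [PartialOrder A]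
    [StarOrderedRing A] : Prop where
  isSimple : CStarIsSimple A
  exists_infinite : ∀ B : NonUnitalStarSubalgebra ℂ A, IsHereditaryCStarSubalgebra B → B ≠ ⊥ →
    ∃ p ∈ B, IsInfiniteProjection p

/-- A unital completely positive map `V : A → B` is nuclear if it is a limit, in the topology of
pointwise norm convergence, of maps `T ∘ S` with `S : A → Mₙ(ℂ)` and `T : Mₙ(ℂ) → B` unital and
completely positive. -/
def IsNuclearUCP {A B : Type*} [CStarAlgebra A] [PartialOrder A] [StarOrderedRing A]
    [CStarAlgebra B] [PartialOrder B] [StarOrderedRing B] (V : A →CP B) : Prop :=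
  ∀ F : Finset A, ∀ ε : ℝ, 0 < ε →
    ∃ (n : ℕ) (S : A →CP CStarMatrix (Fin n) (Fin n) ℂ) (T : CStarMatrix (Fin n) (Fin n) ℂ →CP B),
      S 1 = 1 ∧ T 1 = 1 ∧ ∀ a ∈ F, ‖T (S a) - V a‖ < ε

/-! ### Simplicity and sequences of isometries with orthogonal ranges. -/

section PurelyInfinite

variable {A : Type*} [CStarAlgebra A]

/-! By nuclearity it is enough to implement `T ∘ S` through `Mₙ(ℂ)`. Suppose `x i` satisfy `star (x
i) * a * x j ≈ S(a) i j • 1`. Choi's theorem writes `T` through a Gram matrix, which isometries with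
orthogonal ranges realise as `star (W i) * W j`. Then `s₀ = ∑ x i * W i` compresses `a` to nearly `T
(S a)`; taking `a = 1`, `s₀` is almost an isometry, and polar decomposition corrects it. One unused
isometry shows that the result is not unitary.

The `x i` come from `ScalarCompression.apply_mem_compressionSet`. Pure infiniteness gives isometries
compressing every element asymptotically to a scalar `φ a`. The families approximable by some `x`
form a closed convex cone containing every `φ (star (b i) * a * b j)`. A functional separating `S`
from this cone is given by a matrix over `A`; simplicity makes its hermitian part positive, so
complete positivity of `S` gives a contradiction. -/

theorem CStarIsSimple.exists_sum_mul_mul_eq_one (hA : CStarIsSimple A) {w : A} (hw : w ≠ 0) :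
    ∃ (m : ℕ) (a b : Fin m → A), ∑ i, a i * w * b i = 1 := by
  let J : Submodule ℂ A := Submodule.span ℂ (Set.range fun c : A × A => c.1 * w * c.2)
  have hl : ∀ x, ∀ y ∈ J, x * y ∈ J := by
    intro x y hy
    induction hy using Submodule.span_induction with
    | mem y hy =>
      obtain ⟨c, rfl⟩ := hy
      exact Submodule.subset_span ⟨(x * c.1, c.2), by simp [mul_assoc]⟩
    | zero => simp
    | add y z _ _ hy hz => rw [mul_add]; exact J.add_mem hy hz
    | smul c y _ hy => rw [mul_smul_comm]; exact J.smul_mem c hy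
  have hr : ∀ x, ∀ y ∈ J, y * x ∈ J := by
    intro x y hy
    induction hy using Submodule.span_induction with
    | mem y hy =>
      obtain ⟨c, rfl⟩ := hy
      exact Submodule.subset_span ⟨(c.1, c.2 * x), by simp [mul_assoc]⟩
    | zero => simp
    | add y z _ _ hy hz => rw [add_mul]; exact J.add_mem hy hz
    | smul c y _ hy => rw [smul_mul_assoc]; exact J.smul_mem c hy
  let I : TwoSidedIdeal A := TwoSidedIdeal.mk' (J.topologicalClosure : Set A)
    (J.topologicalClosure.zero_mem) (J.topologicalClosure.add_mem)
    (J.topologicalClosure.neg_mem)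
    (fun {x y} hy => map_mem_closure (f := (x * ·)) (continuous_const_mul x) hy
      (fun z hz => hl x z hz))
    (fun {x y} hx => map_mem_closure (f := (· * y)) (continuous_mul_const y) hx
      (fun z hz => hr y z hz))
  have hI : (I : Set A) = closure (J : Set A) := TwoSidedIdeal.coe_mk' ..
  have hwI : w ∈ I := by
    rw [← SetLike.mem_coe, hI]
    exact subset_closure (Submodule.subset_span ⟨(1, 1), by simp⟩)
  rcases hA.eq_bot_or_eq_top I (by rw [hI]; exact isClosed_closure) with h | h
  · rw [h] at hwI
    exact absurd (by simpa using hwI) hw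
  have h1 : (1 : A) ∈ closure (J : Set A) := by
    rw [← hI, h]; trivial
  obtain ⟨u, huJ, hu⟩ := Metric.mem_closure_iff.1 h1 1 one_pos
  -- The algebraic ideal comes within distance 1 of `1`, so it contains a unit and hence `1` itself:
  -- the sum is exact.
  have hunit : IsUnit u := by
    have := isUnit_one_sub_of_norm_lt_one (x := 1 - u) (by rwa [← dist_eq_norm])
    simpa using this
  obtain ⟨u, rfl⟩ := hunit
  have h1J : (1 : A) ∈ J := by
    have := hl (↑u⁻¹) _ huJ
    simpa using this
  obtain ⟨c, hc⟩ := Finsupp.mem_span_range_iff_exists_finsupp.1 h1J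
  refine ⟨c.support.card, fun i => c (c.support.equivFin.symm i) • (c.support.equivFin.symm i).1.1,
    fun i => (c.support.equivFin.symm i).1.2, ?_⟩
  rw [← hc, Finsupp.sum, ← Finset.sum_coe_sort c.support,
    ← Equiv.sum_comp c.support.equivFin.symm fun i => c i • (i.1.1 * w * i.1.2)]
  simp

variable [PartialOrder A] [StarOrderedRing A]

/-- Since `1 = star y * (star x * x) * y ≤ ‖x‖² • (star y * y)`, the element `star y * y` is
invertible, and `r` is its inverse square root. Thus `y * r` is an isometry. -/
theorem exists_isSelfAdjoint_mul_mul_eq_one {x y : A} (h : x * y = 1) :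
    ∃ r : A, IsSelfAdjoint r ∧ r * (star y * y) * r = 1 := by
  rcases subsingleton_or_nontrivial A with _ | _
  · exact ⟨0, .zero _, Subsingleton.elim _ _⟩
  have hx : x ≠ 0 := by rintro rfl; simp at h
  have hg : IsUnit (star y * y) := by
    have hle : (1 : A) ≤ star (‖x‖ • y) * (‖x‖ • y) := by
      calc (1 : A) = star y * (star x * x) * y := by
            rw [← mul_assoc, ← star_mul, mul_assoc, h]; simp
        _ ≤ star y * (algebraMap ℝ A ‖star x * x‖) * y :=
            star_left_conjugate_le_conjugate
              (IsSelfAdjoint.le_algebraMap_norm_self (IsSelfAdjoint.star_mul_self x)) y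
        _ = star (‖x‖ • y) * (‖x‖ • y) := by
            rw [CStarRing.norm_star_mul_self, Algebra.algebraMap_eq_smul_one]
            simp [smul_smul]
    have := CStarAlgebra.isUnit_of_le 1 hle
    have h2 : star (‖x‖ • y) * (‖x‖ • y) = (Units.mk0 (‖x‖ * ‖x‖) (by simpa)) • (star y * y) := by
      simp [smul_smul, Units.smul_def]
    rw [h2] at this
    have h3 := this.smul (Units.mk0 (‖x‖ * ‖x‖) (by simpa))⁻¹
    simpa using h3
  have hs : IsUnit (CFC.sqrt (star y * y)) := by
    have h1 := CFC.sqrt_mul_sqrt_self (star y * y)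
    rw [← h1] at hg
    exact (Commute.refl _).isUnit_mul_iff.1 hg |>.1
  obtain ⟨u, hu⟩ := hs
  have hsa : IsSelfAdjoint (u : A) := by rw [hu]; exact (CFC.sqrt_nonneg _).isSelfAdjoint
  refine ⟨↑u⁻¹, ?_, ?_⟩
  · have : IsSelfAdjoint u := Units.ext hsa.star_eq
    rw [IsSelfAdjoint, ← Units.coe_star, star_inv, this.star_eq]
  · rw [← CFC.sqrt_mul_sqrt_self (star y * y), ← hu]
    simp

/-- Every infinite projection in a simple C⋆-algebra dominates an infinite sequence of isometries
with mutually orthogonal ranges. -/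
theorem IsInfiniteProjection.exists_isometries (hA : CStarIsSimple A) {q : A}
    (hq : IsInfiniteProjection q) :
    ∃ z : ℕ → A, (∀ k l, star (z k) * z l = if k = l then 1 else 0) ∧ ∀ k, q * z k = z k := by
  obtain ⟨hp, v, hv, hle, hne⟩ := hq
  set w := q - v * star v with hw
  have hqq : q * q = q := hp.isIdempotentElem
  have hqs : star q = q := hp.isSelfAdjoint
  have hvq : v * q = v := by
    have : star (v * (1 - q)) * (v * (1 - q)) = 0 := by
      have : star (v * (1 - q)) * (v * (1 - q)) = (1 - q) * (star v * v) * (1 - q) := by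
        simp [hqs, mul_assoc]
      rw [this, hv]; simp [mul_sub, sub_mul, hqq]
    have := (CStarRing.star_mul_self_eq_zero_iff _).1 this
    rw [mul_sub, mul_one, sub_eq_zero] at this
    exact this.symm
  have hqv : q * v = v := by
    have h0 : (1 - q) * v = 0 := by
      have h1 : (1 - q) * v * star ((1 - q) * v) ≤ 0 := by
        have := star_right_conjugate_le_conjugate hle (1 - q)
        calc _ = (1 - q) * (v * star v) * star (1 - q) := by simp [mul_assoc]
          _ ≤ _ := this
          _ = 0 := by simp [mul_sub, sub_mul, hqq, hqs]
      have h2 := le_antisymm h1 (mul_star_self_nonneg _)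
      exact (CStarRing.mul_star_self_eq_zero_iff _).1 h2
    rw [sub_mul, one_mul, sub_eq_zero] at h0
    exact h0.symm
  have hvsq : star v * q = star v := by rw [← hqs, ← star_mul, hqv]
  have hqvs : q * star v = star v := by nth_rw 1 [← hqs]; rw [← star_mul, hvq]
  have hvw : star v * w = 0 := by
    rw [hw, mul_sub, hvsq, ← mul_assoc, hv, hqvs, sub_self]
  have hqw : q * w = w := by rw [hw, mul_sub, hqq, ← mul_assoc, hqv]
  have hws : star w = w := by simp [hw, hqs]
  have hwq : w * q = w := by rw [← hws, ← hqs, ← star_mul, hqw]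
  have hww : w * w = w := by
    nth_rw 1 [hw]
    rw [sub_mul, hqw, mul_assoc, hvw]; simp
  have hwv : w * v = 0 := by rw [← hws, ← star_star v, ← star_mul, hvw, star_zero]
  have hw0 : w ≠ 0 := by
    intro h; apply hne; rw [eq_comm, ← sub_eq_zero]; exact h
  -- The defect `w` is a wandering projection for `v`: the `v ^ n * w` are partial isometries with
  -- source `w` and orthogonal ranges.
  have hqpow : ∀ n, q * (v ^ n * w) = v ^ n * w := by
    intro n
    cases n with
    | zero => simpa using hqw
    | succ n => rw [pow_succ', mul_assoc, ← mul_assoc q, hqv]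
  have horth : ∀ n m, star (v ^ n * w) * (v ^ m * w) = if n = m then w else 0 := by
    intro n
    induction n with
    | zero =>
      intro m
      cases m with
      | zero => simp [hws, hww]
      | succ m => simp [hws, pow_succ', ← mul_assoc, hwv]
    | succ n ih =>
      intro m
      cases m with
      | zero =>
        have : star (v ^ (n + 1) * w) * (v ^ 0 * w) = star (v ^ n * w) * (star v * w) := by
          simp [pow_succ', mul_assoc]
        rw [this, hvw]; simp
      | succ m =>
        have : star (v ^ (n + 1) * w) * (v ^ (m + 1) * w)
            = star (v ^ n * w) * (q * (v ^ m * w)) := by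
          rw [← hv]; simp [pow_succ', mul_assoc]
        rw [this, hqpow, ih]; simp
  obtain ⟨m, a, b, hab⟩ := hA.exists_sum_mul_mul_eq_one hw0
  -- `Nat.pair` gives each `k` its own `m` shifts of `w`, so the `y k` are orthogonal with one
  -- common Gram element, and a single `r` normalises them all.
  let y : ℕ → A := fun k => ∑ i : Fin m, v ^ (Nat.pair k i) * w * b i
  have hyy : ∀ k l, star (y k) * y l = if k = l then ∑ i, star (b i) * w * b i else 0 := by
    intro k l
    have : star (y k) * y l = ∑ i : Fin m, ∑ j : Fin m,
        star (b i) * (star (v ^ (Nat.pair k i) * w) * (v ^ (Nat.pair l j) * w)) * b j := by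
      simp only [y, star_sum, Finset.sum_mul_sum, star_mul, mul_assoc]
    rw [this]
    simp only [horth, Nat.pair_eq_pair, Fin.val_inj]
    by_cases hkl : k = l
    · simp [hkl]
    · simp [hkl]
  have hxy : (∑ i : Fin m, a i * star (v ^ (Nat.pair 0 i) * w)) * y 0 = 1 := by
    rw [← hab, Finset.sum_mul]
    refine Finset.sum_congr rfl fun i _ => ?_
    have : a i * star (v ^ (Nat.pair 0 i) * w) * y 0 =
        ∑ j : Fin m, a i * (star (v ^ (Nat.pair 0 i) * w) * (v ^ (Nat.pair 0 j) * w)) * b j := by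
      simp only [y, Finset.mul_sum, mul_assoc]
    rw [this]
    simp only [horth, Nat.pair_eq_pair, Fin.val_inj]
    simp
  obtain ⟨r, hr, hr1⟩ := exists_isSelfAdjoint_mul_mul_eq_one hxy
  rw [hyy, if_pos rfl] at hr1
  refine ⟨fun k => y k * r, fun k l => ?_, fun k => ?_⟩
  · have : star (y k * r) * (y l * r) = r * (star (y k) * y l) * r := by
      simp [hr.star_eq, mul_assoc]
    rw [this, hyy]
    by_cases hkl : k = l
    · simp [hkl, hr1]
    · simp [hkl]
  · rw [← mul_assoc]
    congr 1
    simp only [y, Finset.mul_sum]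
    exact Finset.sum_congr rfl fun i _ => by rw [← mul_assoc, hqpow]

end PurelyInfinite

/-! ### Compression to scalars by isometries. -/

section Excision

open Filter Topology

variable {A : Type*} [CStarAlgebra A]

theorem norm_le_one_of_star_mul_self_eq_one {z : A} (hz : star z * z = 1) : ‖z‖ ≤ 1 := by
  rcases subsingleton_or_nontrivial A with _ | _
  · simp [Subsingleton.elim z 0]
  have := CStarRing.norm_star_mul_self (x := z)
  rw [hz, CStarRing.norm_one] at this
  nlinarith [norm_nonneg z]

theorem norm_star_mul_mul_le_of_isometry {r s : A} (hr : star r * r = 1) (hs : star s * s = 1)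
    (a : A) : ‖star r * a * s‖ ≤ ‖a‖ := by
  have h1 := norm_le_one_of_star_mul_self_eq_one hr
  have h2 := norm_le_one_of_star_mul_self_eq_one hs
  calc ‖star r * a * s‖ ≤ ‖star r‖ * ‖a‖ * ‖s‖ := norm_mul₃_le
    _ ≤ 1 * ‖a‖ * 1 := by rw [norm_star]; gcongr
    _ = ‖a‖ := by ring

theorem norm_star_mul_mul_le {z : A} (hz : star z * z = 1) (a : A) : ‖star z * a * z‖ ≤ ‖a‖ :=
  norm_star_mul_mul_le_of_isometry hz hz a

/-- The two-sided annihilator of a set of self-adjoint elements. -/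
def selfAdjointAnnihilator (N : Set A) (hN : ∀ n ∈ N, IsSelfAdjoint n) :
    NonUnitalStarSubalgebra ℂ A where
  carrier := {y | ∀ n ∈ N, n * y = 0 ∧ y * n = 0}
  add_mem' hx hy n hn := by
    simp [mul_add, add_mul, hx n hn, hy n hn]
  zero_mem' n hn := by simp
  mul_mem' {x y} hx hy n hn := by
    rw [← mul_assoc, (hx n hn).1, mul_assoc, (hy n hn).2]; simp
  smul_mem' c x hx n hn := by simp [hx n hn]
  star_mem' {x} hx n hn := by
    have h1 := congrArg star (hx n hn).1
    have h2 := congrArg star (hx n hn).2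
    rw [star_mul, (hN n hn).star_eq, star_zero] at h1 h2
    exact ⟨h2, h1⟩

theorem mem_selfAdjointAnnihilator {N : Set A} {hN : ∀ n ∈ N, IsSelfAdjoint n} {y : A} :
    y ∈ selfAdjointAnnihilator N hN ↔ ∀ n ∈ N, n * y = 0 ∧ y * n = 0 := Iff.rfl

variable [PartialOrder A] [StarOrderedRing A]

theorem isHereditaryCStarSubalgebra_selfAdjointAnnihilator (N : Set A)
    (hN : ∀ n ∈ N, IsSelfAdjoint n) :
    IsHereditaryCStarSubalgebra (selfAdjointAnnihilator N hN) where
  isClosed := by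
    have : (selfAdjointAnnihilator N hN : Set A) =
        ⋂ n ∈ N, ({y | n * y = 0} ∩ {y | y * n = 0}) := by
      ext y; simp [mem_selfAdjointAnnihilator]
    rw [this]
    refine isClosed_biInter fun n _ => ?_
    exact (isClosed_eq (continuous_const_mul n) continuous_const).inter
      (isClosed_eq (continuous_mul_const n) continuous_const)
  mem_of_le b hb a ha hab n hn := by
    have hns := (hN n hn).star_eq
    obtain ⟨c, rfl⟩ := CStarAlgebra.nonneg_iff_eq_star_mul_self.1 ha
    have h1 : star (c * n) * (c * n) ≤ 0 := by
      calc star (c * n) * (c * n) = star n * (star c * c) * n := by simp [mul_assoc]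
        _ ≤ star n * b * n := star_left_conjugate_le_conjugate hab n
        _ = 0 := by rw [mul_assoc, (hb n hn).2, mul_zero]
    have h2 := (CStarRing.star_mul_self_eq_zero_iff _).1 (le_antisymm h1 (star_mul_self_nonneg _))
    constructor
    · have h3 := congrArg star h2
      rw [star_mul, hns, star_zero] at h3
      rw [← mul_assoc, h3, zero_mul]
    · rw [mul_assoc, h2, mul_zero]

/-- Near a nonzero spectral value `M` of `x = p * a * p`, split `x - M = k(x) + r(x)` with `‖k(x)‖ ≤
δ`. An infinite projection below `p` that annihilates `r(x)` sees only `M + k(x)`. -/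
theorem IsPurelyInfiniteSimple.exists_infinite_compression_of_isSelfAdjoint
    (hA : IsPurelyInfiniteSimple A) {p : A} (hp : IsInfiniteProjection p) {a : A}
    (ha : IsSelfAdjoint a) {δ : ℝ} (hδ : 0 < δ) :
    ∃ q : A, IsInfiniteProjection q ∧ p * q = q ∧ ∃ c : ℝ, ‖q * a * q - c • q‖ ≤ δ := by
  have hpp : p * p = p := hp.1.isIdempotentElem
  have hps : star p = p := hp.1.isSelfAdjoint
  set x := p * a * p with hx
  have hxs : IsSelfAdjoint x := by
    rw [IsSelfAdjoint, hx]; simp [hps, ha.star_eq, mul_assoc]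
  by_cases hx0 : x = 0
  · exact ⟨p, hp, hpp, 0, by simp [← hx, hx0, hδ.le]⟩
  obtain ⟨M, hM, hM0⟩ : ∃ M ∈ spectrum ℝ x, M ≠ 0 := by
    by_contra! h
    exact hx0 (CFC.eq_zero_of_spectrum_subset_zero (R := ℝ) x (fun t ht => h t ht) hxs)
  let k : ℝ → ℝ := fun t => max (-δ) (min δ (t - M))
  let r : ℝ → ℝ := fun t => (t - M) - k t
  let g : ℝ → ℝ := fun t => max 0 (δ - |t - M|)
  have hk : Continuous k := by fun_prop
  have hr : Continuous r := by fun_prop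
  have hg : Continuous g := by fun_prop
  have hrg : ∀ t, r t * g t = 0 := by
    intro t
    simp only [r, g, k]
    rcases le_total δ |t - M| with h | h
    · rw [max_eq_left (by linarith : δ - |t - M| ≤ 0), mul_zero]
    · obtain ⟨h1, h2⟩ := abs_le.1 h
      rw [min_eq_right h2, max_eq_right h1]; simp
  have hrg0 : cfc r x * cfc g x = 0 := by
    rw [← cfc_mul r g x hr.continuousOn hg.continuousOn]
    simp only [hrg]
    exact cfc_const_zero ℝ x
  have hN : ∀ n ∈ ({cfc r x, 1 - p} : Set A), IsSelfAdjoint n := by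
    rintro n (rfl | rfl)
    · exact cfc_predicate r x
    · simp [IsSelfAdjoint, hps]
  have hne : selfAdjointAnnihilator _ hN ≠ ⊥ := by
    intro hbot
    -- The factor `x` makes `1 - p` annihilate the element, which `g(x)` alone need not satisfy; `M
    -- ≠ 0` keeps the product nonzero.
    have hmem : x * cfc g x ∈ selfAdjointAnnihilator _ hN := by
      have hc1 : x * cfc g x = cfc g x * x := by
        have := (cfc_commute_cfc (fun t => t) g x).eq
        rwa [cfc_id' ℝ x] at this
      rw [mem_selfAdjointAnnihilator]
      rintro n (rfl | rfl)
      · constructor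
        · rw [hc1, ← mul_assoc, hrg0, zero_mul]
        · rw [mul_assoc, (cfc_commute_cfc g r x).eq, hrg0, mul_zero]
      · constructor
        · rw [← mul_assoc, hx]; simp [sub_mul, ← mul_assoc, hpp]
        · rw [hc1, hx]; simp [mul_sub, mul_assoc, hpp]
    rw [hbot, NonUnitalStarAlgebra.mem_bot] at hmem
    have h2 : cfc (fun t => t * g t) x = 0 := by
      rw [cfc_mul (fun t => t) g x continuousOn_id hg.continuousOn, cfc_id' ℝ x, hmem]
    have h3 := cfc_map_spectrum (fun t => t * g t) x (hf := by fun_prop)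
    have : Nontrivial A := hA.isSimple.nontrivial
    rw [h2, spectrum.zero_eq] at h3
    have h4 : M * g M ∈ ({0} : Set ℝ) := by rw [h3]; exact ⟨M, hM, rfl⟩
    simp [g, hM0, hδ.le, hδ.ne'] at h4
  obtain ⟨q, hqB, hq⟩ := hA.exists_infinite _
    (isHereditaryCStarSubalgebra_selfAdjointAnnihilator _ hN) hne
  have hqn := (hqB (cfc r x) (by simp)).1
  have hpq : p * q = q := by
    have := (hqB (1 - p) (by simp)).1
    rw [sub_mul, one_mul, sub_eq_zero] at this
    exact this.symm
  have hqq : q * q = q := hq.1.isIdempotentElem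
  have hqs : star q = q := hq.1.isSelfAdjoint
  have hqp : q * p = q := by
    have := congrArg star hpq
    rwa [star_mul, hqs, hps] at this
  have hq1 : ‖q‖ ≤ 1 := by
    have := CStarRing.norm_star_mul_self (x := q)
    rw [hqs, hqq] at this
    nlinarith [norm_nonneg q]
  refine ⟨q, hq, hpq, M, ?_⟩
  have hsum : x - algebraMap ℝ A M = cfc k x + cfc r x := by
    rw [← cfc_add x k r hk.continuousOn hr.continuousOn]
    have : (fun t => k t + r t) = fun t => t - M := by funext t; simp [r]
    rw [this, cfc_sub (fun t => t) (fun _ => M) x, cfc_id' ℝ x, cfc_const M x]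
  have hqa : q * a * q = q * x * q := by
    rw [hx]
    have : q * (p * a * p) * q = (q * p) * a * (p * q) := by simp only [mul_assoc]
    rw [this, hqp, hpq]
  have heq : q * a * q - M • q = q * cfc k x * q := by
    have h1 : q * (x - algebraMap ℝ A M) * q = q * cfc k x * q := by
      rw [hsum, mul_add, add_mul, mul_assoc q (cfc r x), hqn]; simp
    rw [← h1, hqa, mul_sub, sub_mul, Algebra.algebraMap_eq_smul_one]
    simp [hqq]
  have hkn : ‖cfc k x‖ ≤ δ := by
    refine norm_cfc_le hδ.le fun t _ => ?_
    rw [Real.norm_eq_abs, abs_le]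
    exact ⟨le_max_left _ _, max_le (by linarith) (min_le_left _ _)⟩
  rw [heq]
  calc _ ≤ ‖q‖ * ‖cfc k x‖ * ‖q‖ := norm_mul₃_le
    _ ≤ 1 * δ * 1 := by gcongr
    _ = δ := by ring

/-- Estimates survive cutting down to a subprojection, so finitely many elements can be treated in
succession. -/
theorem IsInfiniteProjection.norm_compression_le {p q a : A} (hp : IsInfiniteProjection p)
    (hq : IsInfiniteProjection q) (hpq : p * q = q) {c : ℂ} {δ : ℝ}
    (h : ‖p * a * p - c • p‖ ≤ δ) : ‖q * a * q - c • q‖ ≤ δ := by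
  have hqq : q * q = q := hq.1.isIdempotentElem
  have hqs : star q = q := hq.1.isSelfAdjoint
  have hps : star p = p := hp.1.isSelfAdjoint
  have hqp : q * p = q := by
    have := congrArg star hpq
    rwa [star_mul, hqs, hps] at this
  have hq1 : ‖q‖ ≤ 1 := by
    have := CStarRing.norm_star_mul_self (x := q)
    rw [hqs, hqq] at this
    nlinarith [norm_nonneg q]
  have heq : q * a * q - c • q = q * (p * a * p - c • p) * q := by
    have : q * (p * a * p) * q = (q * p) * a * (p * q) := by simp only [mul_assoc]
    rw [mul_sub, sub_mul, this, hqp, hpq]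
    simp [hqp, hqq]
  have hδ := (norm_nonneg _).trans h
  rw [heq]
  calc _ ≤ ‖q‖ * ‖p * a * p - c • p‖ * ‖q‖ := norm_mul₃_le
    _ ≤ 1 * δ * 1 := by gcongr
    _ = δ := by ring

theorem IsPurelyInfiniteSimple.exists_infinite_compression
    (hA : IsPurelyInfiniteSimple A) {p : A} (hp : IsInfiniteProjection p) (a : A)
    {δ : ℝ} (hδ : 0 < δ) :
    ∃ q : A, IsInfiniteProjection q ∧ p * q = q ∧ ∃ c : ℂ, ‖q * a * q - c • q‖ ≤ δ := by
  obtain ⟨q₁, hq₁, hpq₁, c₁, hc₁⟩ := hA.exists_infinite_compression_of_isSelfAdjoint hp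
    (realPart a).2 (half_pos hδ)
  obtain ⟨q, hq, hq₁q, c₂, hc₂⟩ := hA.exists_infinite_compression_of_isSelfAdjoint hq₁
    (imaginaryPart a).2 (half_pos hδ)
  refine ⟨q, hq, by rw [← hq₁q, ← mul_assoc, hpq₁], c₁ + Complex.I * c₂, ?_⟩
  have h1 := hq₁.norm_compression_le hq hq₁q (c := c₁) (by simpa using hc₁)
  have h2 : ‖q * (imaginaryPart a : A) * q - (c₂ : ℂ) • q‖ ≤ δ / 2 := by simpa using hc₂
  have heq : q * a * q - ((c₁ : ℂ) + Complex.I * c₂) • q =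
      (q * (realPart a : A) * q - (c₁ : ℂ) • q) +
        Complex.I • (q * (imaginaryPart a : A) * q - (c₂ : ℂ) • q) := by
    nth_rw 1 [← realPart_add_I_smul_imaginaryPart a]
    simp only [mul_add, add_mul, mul_smul_comm, smul_mul_assoc, add_smul, smul_sub, mul_smul]
    abel
  rw [heq]
  calc _ ≤ _ := norm_add_le _ _
    _ ≤ δ / 2 + δ / 2 := by
      gcongr
      rw [norm_smul]; simpa using h2
    _ = δ := by ring

theorem IsPurelyInfiniteSimple.exists_infinite_compression_finset
    (hA : IsPurelyInfiniteSimple A) (F : Finset A) {δ : ℝ} (hδ : 0 < δ) :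
    ∃ q : A, IsInfiniteProjection q ∧ ∀ a ∈ F, ∃ c : ℂ, ‖q * a * q - c • q‖ ≤ δ := by
  classical
  induction F using Finset.induction_on with
  | empty =>
    have : Nontrivial A := hA.isSimple.nontrivial
    -- The annihilator of the empty set is all of `A`.
    obtain ⟨q, -, hq⟩ := hA.exists_infinite _
      (isHereditaryCStarSubalgebra_selfAdjointAnnihilator ∅ (by simp)) (by
        intro h
        have : (1 : A) ∈ selfAdjointAnnihilator (∅ : Set A) (by simp) := by
          simp [mem_selfAdjointAnnihilator]
        rw [h, NonUnitalStarAlgebra.mem_bot] at this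
        exact one_ne_zero this)
    exact ⟨q, hq, by simp⟩
  | insert a F _ ih =>
    obtain ⟨p, hp, hpF⟩ := ih
    obtain ⟨q, hq, hpq, hqa⟩ := hA.exists_infinite_compression hp a hδ
    refine ⟨q, hq, fun b hb => ?_⟩
    rcases Finset.mem_insert.1 hb with rfl | hb
    · exact hqa
    · obtain ⟨c, hc⟩ := hpF b hb
      exact ⟨c, hp.norm_compression_le hq hpq hc⟩

theorem IsPurelyInfiniteSimple.exists_isometry_approx
    (hA : IsPurelyInfiniteSimple A) (F : Finset A) {δ : ℝ} (hδ : 0 < δ) :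
    ∃ z : A, star z * z = 1 ∧ ∀ a ∈ F, ∃ c : ℂ, ‖star z * a * z - c • 1‖ ≤ δ := by
  obtain ⟨q, hq, hF⟩ := hA.exists_infinite_compression_finset F hδ
  obtain ⟨z, hz, hqz⟩ := hq.exists_isometries hA.isSimple
  have hz0 : star (z 0) * z 0 = 1 := by simpa using hz 0 0
  have hqs : star q = q := hq.1.isSelfAdjoint
  have hzq : star (z 0) * q = star (z 0) := by rw [← hqs, ← star_mul, hqz]
  refine ⟨z 0, hz0, fun a ha => ?_⟩
  obtain ⟨c, hc⟩ := hF a ha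
  refine ⟨c, ?_⟩
  have : star (z 0) * a * z 0 - c • 1 = star (z 0) * (q * a * q - c • q) * z 0 := by
    have h1 : star (z 0) * (q * a * q) * z 0 = (star (z 0) * q) * a * (q * z 0) := by
      simp only [mul_assoc]
    rw [mul_sub, sub_mul, h1, hzq, hqz]
    simp [hzq, hz0]
  rw [this]
  exact (norm_star_mul_mul_le hz0 _).trans hc

/-- A net of isometries in `A` compressing every element asymptotically to a scalar. -/
structure ScalarCompression {A : Type*} [CStarAlgebra A] {ι : Type*} (l : Filter ι) (z : ι → A)
    (φ : A →ₗ[ℂ] ℂ) : Prop where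
  neBot : l.NeBot
  isometry : ∀ i, star (z i) * z i = 1
  tendsto : ∀ a, Tendsto (fun i => star (z i) * a * z i) l (𝓝 (φ a • 1))

/-- The approximating scalars for `a` are eventually bounded by `‖a‖ + 1`, so they converge along an
ultrafilter; uniqueness of limits makes `φ` linear. -/
theorem IsPurelyInfiniteSimple.exists_scalarCompression (hA : IsPurelyInfiniteSimple A) :
    ∃ (l : Filter (Finset A × ℕ)) (z : Finset A × ℕ → A) (φ : A →ₗ[ℂ] ℂ),
      ScalarCompression l z φ := by
  classical
  have : Nontrivial A := hA.isSimple.nontrivial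
  have hex : ∀ i : Finset A × ℕ, ∃ z : A, star z * z = 1 ∧
      ∀ a ∈ i.1, ∃ c : ℂ, ‖star z * a * z - c • 1‖ ≤ 1 / ((i.2 : ℝ) + 1) := fun i =>
    hA.exists_isometry_approx i.1 (by positivity)
  choose z hz hzc using hex
  let l : Ultrafilter (Finset A × ℕ) := Ultrafilter.of atTop
  have hl : (l : Filter (Finset A × ℕ)) ≤ atTop := Ultrafilter.of_le atTop
  have key : ∀ a, ∃ c : ℂ, Tendsto (fun i => star (z i) * a * z i) l (𝓝 (c • 1)) := by
    intro a
    have hev : ∀ᶠ i in (l : Filter (Finset A × ℕ)), a ∈ i.1 := by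
      refine hl ((eventually_ge_atTop ({a}, 0)).mono fun i hi => ?_)
      simpa using hi.1
    have hc : ∀ i, ∃ c : ℂ, a ∈ i.1 → ‖star (z i) * a * z i - c • 1‖ ≤ 1 / ((i.2 : ℝ) + 1) := by
      intro i
      by_cases h : a ∈ i.1
      · obtain ⟨c, hc⟩ := hzc i a h
        exact ⟨c, fun _ => hc⟩
      · exact ⟨0, fun h' => absurd h' h⟩
    choose c hc using hc
    have hlim : Tendsto (fun i => star (z i) * a * z i - c i • (1 : A)) l (𝓝 0) := by
      have h0 : Tendsto (fun i : Finset A × ℕ => 1 / ((i.2 : ℝ) + 1)) l (𝓝 0) :=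
        (tendsto_one_div_add_atTop_nhds_zero_nat (𝕜 := ℝ)).comp
          ((tendsto_snd.mono_left (by rw [prod_atTop_atTop_eq])).mono_left hl)
      exact squeeze_zero_norm' (hev.mono fun i hi => hc i hi) h0
    have hbd : ∀ᶠ i in (l : Filter (Finset A × ℕ)), c i ∈ Metric.closedBall (0 : ℂ) (‖a‖ + 1) := by
      refine hev.mono fun i hi => ?_
      rw [mem_closedBall_zero_iff]
      have h1 := hc i hi
      have h2 := norm_star_mul_mul_le (hz i) a
      have h3 : 1 / ((i.2 : ℝ) + 1) ≤ 1 := by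
        rw [div_le_one (by positivity)]; linarith [(Nat.cast_nonneg i.2 : (0 : ℝ) ≤ _)]
      have h4 : ‖c i • (1 : A)‖ = ‖c i‖ := by rw [norm_smul, CStarRing.norm_one, mul_one]
      have h5 := norm_sub_norm_le (c i • (1 : A)) (star (z i) * a * z i)
      rw [norm_sub_rev] at h5
      linarith
    obtain ⟨c₀, -, hc₀⟩ := (isCompact_closedBall (0 : ℂ) (‖a‖ + 1)).ultrafilter_le_nhds'
      (l.map c) (by rw [Ultrafilter.mem_map]; exact hbd)
    have hc₀' : Tendsto c l (𝓝 c₀) := hc₀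
    refine ⟨c₀, ?_⟩
    have := hlim.add (hc₀'.smul_const (1 : A))
    simpa using this
  choose φ hφ using key
  have huniq : ∀ {a : A} {c : ℂ}, Tendsto (fun i => star (z i) * a * z i) l (𝓝 (c • 1)) →
      φ a = c := fun {a c} h =>
    (smul_left_injective ℂ (one_ne_zero (α := A))) (tendsto_nhds_unique (hφ a) h)
  refine ⟨l, z, ⟨⟨φ, fun a b => huniq ?_⟩, fun c a => huniq ?_⟩, inferInstance, hz, hφ⟩
  · simpa only [mul_add, add_mul, add_smul] using (hφ a).add (hφ b)
  · simpa [mul_smul] using (hφ a).const_smul c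

end Excision

/-! ### Positivity tests and Choi's decomposition. -/

section Positivity

variable {A : Type*} [CStarAlgebra A] [PartialOrder A] [StarOrderedRing A]

theorem exists_eq_star_mul_self_of_nonneg {a : A} (ha : 0 ≤ a) : ∃ b : A, a = star b * b :=
  CStarAlgebra.nonneg_iff_eq_star_mul_self.1 ha

/-- Conjugating by `y⁻` gives `-(y⁻)³`. This certificate reduces each positivity test to showing `u
= 0`. -/
theorem IsSelfAdjoint.exists_conj_eq_neg_star_mul_self {y : A} (hy : IsSelfAdjoint y) :
    ∃ t u : A, star t * y * t = -(star u * u) ∧ (u = 0 → 0 ≤ y) := by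
  have ht : 0 ≤ y⁻ := CFC.negPart_nonneg y
  have hts : star y⁻ = y⁻ := ht.isSelfAdjoint
  obtain ⟨r, hr⟩ := CStarAlgebra.nonneg_iff_eq_star_mul_self.1 ht
  have hy' := CFC.posPart_sub_negPart y hy
  refine ⟨y⁻, r * y⁻, ?_, fun h => ?_⟩
  · have : star (r * y⁻) * (r * y⁻) = y⁻ * (star r * r) * y⁻ := by simp [hts, mul_assoc]
    rw [this, ← hr, hts]
    nth_rw 2 [← hy']
    rw [mul_sub, sub_mul, CFC.negPart_mul_posPart]
    simp
  · have h1 : star y⁻ * y⁻ = 0 := by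
      rw [hts]; nth_rw 1 [hr]; rw [mul_assoc, h, mul_zero]
    have h2 := (CStarRing.star_mul_self_eq_zero_iff _).1 h1
    rw [h2, sub_zero] at hy'
    rw [← hy']
    exact CFC.posPart_nonneg y

theorem CStarMatrix.nonneg_of_forall_sum_nonneg {n : Type*} [Fintype n] [DecidableEq n]
    {H : CStarMatrix n n A} (hH : IsSelfAdjoint H)
    (h : ∀ b : n → A, 0 ≤ ∑ i, ∑ j, star (b i) * H i j * b j) : 0 ≤ H := by
  obtain ⟨t, u, htu, hu⟩ := hH.exists_conj_eq_neg_star_mul_self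
  refine hu ?_
  ext l k
  have h1 : (star t * H * t) k k = ∑ i, ∑ j, star (t i k) * H i j * t j k := by
    rw [Finset.sum_comm]
    simp [CStarMatrix.mul_apply, Finset.sum_mul, CStarMatrix.star_apply]
  have h2 : (star u * u) k k = ∑ i, star (u i k) * u i k := by
    simp [CStarMatrix.mul_apply, CStarMatrix.star_apply]
  -- The columns of `t` serve as test vectors.
  have h3 := h fun i => t i k
  rw [← h1, htu, CStarMatrix.neg_apply, h2, neg_nonneg] at h3
  have h4 : ∀ i ∈ Finset.univ, 0 ≤ star (u i k) * u i k := fun i _ => star_mul_self_nonneg _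
  have h5 := (Finset.sum_eq_zero_iff_of_nonneg h4).1 (le_antisymm h3 (Finset.sum_nonneg h4)) l
    (Finset.mem_univ l)
  exact (CStarRing.star_mul_self_eq_zero_iff _).1 h5

/-- The sum is the quadratic form of the positive matrix `(S (H i j))` at the vector `∑ eᵢ ⊗ eᵢ`. -/
theorem CompletelyPositiveMap.re_sum_apply_nonneg {n : ℕ}
    (S : A →CP CStarMatrix (Fin n) (Fin n) ℂ) {H : CStarMatrix (Fin n) (Fin n) A} (hH : 0 ≤ H) :
    0 ≤ (∑ i, ∑ j, S (H i j) i j).re := by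
  have hP := S.map_cstarMatrix_nonneg H hH
  obtain ⟨R, hR⟩ := exists_eq_star_mul_self_of_nonneg hP
  have h1 : ∀ i j, S (H i j) i j = ∑ k, ∑ l, star (R k i l i) * R k j l j := by
    intro i j
    have : S (H i j) = (H.map S) i j := rfl
    rw [this, hR]
    simp only [CStarMatrix.mul_apply, CStarMatrix.star_apply]
    have hsum : ∀ (f : Fin n → CStarMatrix (Fin n) (Fin n) ℂ) (s : Finset (Fin n)),
        (∑ k ∈ s, f k) i j = ∑ k ∈ s, f k i j := by
      intro f s
      induction s using Finset.induction_on with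
      | empty => rfl
      | insert a s ha ih => rw [Finset.sum_insert ha, Finset.sum_insert ha, ← ih]; rfl
    rw [hsum]
    simp [CStarMatrix.mul_apply, CStarMatrix.star_apply]
  have h2 : ∑ i, ∑ j, S (H i j) i j =
      ∑ k, ∑ l, star (∑ i, R k i l i) * (∑ j, R k j l j) := by
    simp only [h1, star_sum, Finset.sum_mul_sum]
    calc _ = ∑ i, ∑ k, ∑ j, ∑ l, star (R k i l i) * R k j l j :=
          Finset.sum_congr rfl fun i _ => Finset.sum_comm
      _ = ∑ k, ∑ i, ∑ j, ∑ l, star (R k i l i) * R k j l j := Finset.sum_comm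
      _ = ∑ k, ∑ i, ∑ l, ∑ j, star (R k i l i) * R k j l j :=
          Finset.sum_congr rfl fun k _ => Finset.sum_congr rfl fun i _ => Finset.sum_comm
      _ = _ := Finset.sum_congr rfl fun k _ => Finset.sum_comm
  rw [h2]
  have h3 : (0 : ℂ) ≤ ∑ k, ∑ l, star (∑ i, R k i l i) * (∑ j, R k j l j) :=
    Finset.sum_nonneg fun k _ => Finset.sum_nonneg fun l _ => star_mul_self_nonneg _
  exact (Complex.nonneg_iff.1 h3).1

/-- Choi's description of completely positive maps on matrix algebras. -/
theorem CompletelyPositiveMap.exists_apply_eq_sum {n : ℕ} [NeZero n]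
    (T : CStarMatrix (Fin n) (Fin n) ℂ →CP A) :
    ∃ c : Fin n → Fin n → A, ∀ X, T X = ∑ i, ∑ j, X i j • ∑ k, star (c k i) * c k j := by
  let e : Fin n → Fin n → CStarMatrix (Fin n) (Fin n) ℂ := fun i j =>
    CStarMatrix.ofMatrix (Matrix.single i j 1)
  -- With row `0` equal to `(e 0 j)` and all other rows zero, `star R * R` has entries `star (e 0 i)
  -- * e 0 j = e i j`.
  let R : CStarMatrix (Fin n) (Fin n) (CStarMatrix (Fin n) (Fin n) ℂ) :=
    CStarMatrix.ofMatrix fun k j => if k = 0 then e 0 j else 0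
  let E : CStarMatrix (Fin n) (Fin n) (CStarMatrix (Fin n) (Fin n) ℂ) :=
    CStarMatrix.ofMatrix e
  have he : ∀ i j k l, e i j k l = if i = k ∧ j = l then 1 else 0 := fun i j k l =>
    Matrix.single_apply ..
  have hR : ∀ k j, R k j = if k = 0 then e 0 j else 0 := fun k j => rfl
  have hEe : ∀ i j, E i j = e i j := fun i j => rfl
  have hE : E = star R * R := by
    refine CStarMatrix.ext fun i j => ?_
    rw [CStarMatrix.mul_apply, Finset.sum_eq_single 0]
    · ext k l
      rw [hEe, he, CStarMatrix.star_apply, hR, hR, if_pos rfl, if_pos rfl, CStarMatrix.mul_apply,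
        Finset.sum_eq_single 0]
      · simp only [CStarMatrix.star_apply, he]
        by_cases hi : i = k <;> by_cases hj : j = l <;> simp [hi, hj]
      · intro x _ hx
        simp [he, hx.symm]
      · simp
    · intro k _ hk
      simp [hR, hk]
    · simp
  have hE0 : 0 ≤ E := by rw [hE]; exact star_mul_self_nonneg R
  obtain ⟨C, hC⟩ := exists_eq_star_mul_self_of_nonneg (T.map_cstarMatrix_nonneg E hE0)
  refine ⟨fun k i => C k i, fun X => ?_⟩
  have hT : ∀ i j, T (e i j) = ∑ k, star (C k i) * C k j := by
    intro i j
    have : T (e i j) = (E.map T) i j := rfl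
    rw [this, hC]
    simp [CStarMatrix.mul_apply, CStarMatrix.star_apply]
  have hX : X = ∑ i, ∑ j, X i j • e i j := by
    have := Matrix.matrix_eq_sum_single (CStarMatrix.ofMatrix.symm X)
    refine this.trans (Finset.sum_congr rfl fun i _ => Finset.sum_congr rfl fun j _ => ?_)
    ext k l
    simp [e, Matrix.single_apply]
  nth_rw 1 [hX]
  simp only [map_sum, map_smul, hT]

end Positivity

/-! ### The limit functional `φ` detects positivity. -/

namespace ScalarCompression

open Filter Topology

variable {A : Type*} [CStarAlgebra A] [Nontrivial A] {ι : Type*} {l : Filter ι} {z : ι → A}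
  {φ : A →ₗ[ℂ] ℂ}

theorem eq_of_tendsto (h : ScalarCompression l z φ) {a : A} {c : ℂ}
    (hc : Tendsto (fun i => star (z i) * a * z i) l (𝓝 (c • 1))) : φ a = c :=
  have := h.neBot
  smul_left_injective ℂ (one_ne_zero (α := A)) (tendsto_nhds_unique (h.tendsto a) hc)

theorem map_one (h : ScalarCompression l z φ) : φ 1 = 1 :=
  h.eq_of_tendsto (by simp [h.isometry, tendsto_const_nhds])

theorem map_star (h : ScalarCompression l z φ) (a : A) : φ (star a) = star (φ a) := by
  refine h.eq_of_tendsto ?_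
  simpa [mul_assoc] using (h.tendsto a).star

theorem eq_zero_of_forall (hA : CStarIsSimple A) (h : ScalarCompression l z φ) {x : A}
    (hx : ∀ c d, φ (c * x * d) = 0) : x = 0 := by
  by_contra hne
  obtain ⟨m, a, b, hab⟩ := hA.exists_sum_mul_mul_eq_one hne
  have := h.map_one
  rw [← hab, map_sum] at this
  simp [hx] at this

variable [PartialOrder A] [StarOrderedRing A]

theorem re_map_star_mul_self_nonneg (h : ScalarCompression l z φ) (a : A) :
    0 ≤ (φ (star a * a)).re := by
  have := h.neBot
  have h1 : (0 : A) ≤ φ (star a * a) • 1 := by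
    refine ge_of_tendsto' (h.tendsto _) fun i => ?_
    exact star_left_conjugate_nonneg (star_mul_self_nonneg a) _
  have h2 : star (φ (star a * a)) = φ (star a * a) := by
    rw [← h.map_star]; simp
  obtain ⟨r, hr⟩ : ∃ r : ℝ, (r : ℂ) = φ (star a * a) := Complex.conj_eq_iff_real.1 h2 |>.imp
    fun _ => Eq.symm
  rw [← hr] at h1 ⊢
  by_contra! hneg
  rw [Complex.ofReal_re] at hneg
  have h3 : (0 : A) ≤ ((-r : ℝ) : ℂ) • 1 := by
    have : ((-r : ℝ) : ℂ) • (1 : A) =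
        star (((√(-r) : ℝ) : ℂ) • (1 : A)) * (((√(-r) : ℝ) : ℂ) • (1 : A)) := by
      rw [star_smul, smul_mul_smul_comm, Complex.star_def, Complex.conj_ofReal,
        ← Complex.ofReal_mul, Real.mul_self_sqrt (by linarith)]
      simp
    rw [this]
    exact star_mul_self_nonneg _
  rw [Complex.ofReal_neg, neg_smul, neg_nonneg] at h3
  have h4 := le_antisymm h3 h1
  rw [smul_eq_zero] at h4
  rcases h4 with h4 | h4
  · rw [Complex.ofReal_eq_zero] at h4
    linarith
  · exact one_ne_zero h4

/-- With the certificate `t`, `u`, the number `φ (star (u * d) * (u * d))` is both nonnegative and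
nonpositive. Polarisation then gives `φ (c * (star u * u) * d) = 0` for all `c`, `d`, and simplicity
forces `u = 0`. -/
theorem nonneg_of_forall (hA : CStarIsSimple A) (h : ScalarCompression l z φ) {y : A}
    (hy : IsSelfAdjoint y) (hc : ∀ c, 0 ≤ (φ (star c * y * c)).re) : 0 ≤ y := by
  obtain ⟨t, u, htu, hu⟩ := hy.exists_conj_eq_neg_star_mul_self
  have h0 : ∀ d, φ (star d * (star u * u) * d) = 0 := by
    intro d
    have h1 := hc (t * d)
    have h2 : star (t * d) * y * (t * d) = -(star (u * d) * (u * d)) := by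
      have : star (t * d) * y * (t * d) = star d * (star t * y * t) * d := by
        simp [mul_assoc]
      rw [this, htu]; simp [mul_assoc]
    rw [h2, map_neg, Complex.neg_re] at h1
    have h3 := h.re_map_star_mul_self_nonneg (u * d)
    have h4 : star (φ (star (u * d) * (u * d))) = φ (star (u * d) * (u * d)) := by
      rw [← h.map_star]; simp
    have h5 : star d * (star u * u) * d = star (u * d) * (u * d) := by simp [mul_assoc]
    rw [h5]
    exact Complex.ext (le_antisymm (neg_nonneg.1 h1) h3) (Complex.conj_eq_iff_im.1 h4)
  have hpol : ∀ c d, φ (star c * (star u * u) * d) = 0 := by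
    intro c d
    have h1 := h0 (c + d)
    have h2 := h0 (c + Complex.I • d)
    simp only [star_add, star_smul, add_mul, mul_add, map_add, smul_mul_assoc, mul_smul_comm,
      map_smul, h0, Complex.star_def, Complex.conj_I, smul_eq_mul] at h1 h2
    linear_combination (1 / 2) * h1 - Complex.I / 2 * h2 +
      (φ (star c * (star u * u) * d) - φ (star d * (star u * u) * c)) / 2 * Complex.I_sq
  refine hu ((CStarRing.star_mul_self_eq_zero_iff _).1 (h.eq_zero_of_forall hA fun c d => ?_))
  simpa using hpol (star c) d

end ScalarCompression

/-! ### The cone of approximable families and separation. -/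

section Cone

open Filter Topology

variable {A : Type*} [CStarAlgebra A]

/-- The matrix-valued families on `F` that are approximately of the form
`a ↦ (star (x i) * a * x j)` up to identifying `ℂ` with the scalars of `A`. -/
def compressionSet (F : Finset A) (n : ℕ) : Set (F × Fin n × Fin n → ℂ) :=
  {κ | ∀ ε > 0, ∃ x : Fin n → A, ∀ (a : F) i j,
    ‖star (x i) * a * x j - κ (a, i, j) • 1‖ ≤ ε}

theorem zero_mem_compressionSet (F : Finset A) (n : ℕ) : 0 ∈ compressionSet F n :=
  fun _ hε => ⟨0, fun _ _ _ => by simpa using hε.le⟩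

theorem isClosed_compressionSet [Nontrivial A] (F : Finset A) (n : ℕ) :
    IsClosed (compressionSet F n) := by
  refine isClosed_of_closure_subset fun κ hκ ε hε => ?_
  obtain ⟨κ', hκ', hd⟩ := Metric.mem_closure_iff.1 hκ (ε / 2) (half_pos hε)
  obtain ⟨x, hx⟩ := hκ' (ε / 2) (half_pos hε)
  refine ⟨x, fun a i j => ?_⟩
  have h1 : ‖(κ' (a, i, j) - κ (a, i, j)) • (1 : A)‖ ≤ ε / 2 := by
    rw [norm_smul, CStarRing.norm_one, mul_one, ← dist_eq_norm, dist_comm]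
    exact (dist_le_pi_dist κ κ' _).trans hd.le
  have h2 : star (x i) * a * x j - κ (a, i, j) • 1 =
      (star (x i) * a * x j - κ' (a, i, j) • 1) + (κ' (a, i, j) - κ (a, i, j)) • (1 : A) := by
    rw [sub_smul]; abel
  rw [h2]
  linarith [norm_add_le (star (x i) * a * x j - κ' (a, i, j) • 1)
    ((κ' (a, i, j) - κ (a, i, j)) • (1 : A)), hx a i j]

theorem smul_mem_compressionSet {F : Finset A} {n : ℕ} {κ : F × Fin n × Fin n → ℂ}
    (hκ : κ ∈ compressionSet F n) {c : ℝ} (hc : 0 ≤ c) : c • κ ∈ compressionSet F n := by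
  intro ε hε
  -- Dividing by `c + 1` also covers `c = 0`.
  obtain ⟨x, hx⟩ := hκ (ε / (c + 1)) (by positivity)
  refine ⟨fun i => √c • x i, fun a i j => ?_⟩
  have h1 : star (√c • x i) * a * (√c • x j) - (c • κ) (a, i, j) • (1 : A) =
      c • (star (x i) * a * x j - κ (a, i, j) • 1) := by
    simp only [star_smul, smul_mul_assoc, mul_smul_comm, smul_smul, star_trivial,
      Real.mul_self_sqrt hc, Pi.smul_apply, smul_sub, smul_assoc]
  rw [h1, norm_smul, Real.norm_of_nonneg hc]
  calc c * ‖_‖ ≤ c * (ε / (c + 1)) := by gcongr; exact hx a i j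
    _ ≤ ε := by
      rw [mul_div_assoc', div_le_iff₀ (by positivity)]; nlinarith

variable {ι : Type*} {l : Filter ι} {z : ι → A} {φ : A →ₗ[ℂ] ℂ}

theorem ScalarCompression.exists_forall_norm_le (h : ScalarCompression l z φ) {β : Type*}
    [Finite β] (c : β → A) {ε : ℝ} (hε : 0 < ε) :
    ∃ i, ∀ b, ‖star (z i) * c b * z i - φ (c b) • 1‖ ≤ ε := by
  have := h.neBot
  have hev : ∀ᶠ i in l, ∀ b, ‖star (z i) * c b * z i - φ (c b) • 1‖ ≤ ε := by
    rw [eventually_all]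
    intro b
    filter_upwards [(Metric.tendsto_nhds.1 (h.tendsto (c b))) ε hε] with i hi
    rw [← dist_eq_norm]
    exact hi.le
  exact hev.exists

theorem ScalarCompression.map_mem_compressionSet (h : ScalarCompression l z φ) (F : Finset A)
    {n : ℕ} (b : Fin n → A) :
    (fun p => φ (star (b p.2.1) * p.1 * b p.2.2)) ∈ compressionSet F n := by
  intro ε hε
  obtain ⟨i, hi⟩ := h.exists_forall_norm_le
    (fun p : F × Fin n × Fin n => star (b p.2.1) * p.1 * b p.2.2) hε
  refine ⟨fun k => b k * z i, fun a j k => ?_⟩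
  have := hi (a, j, k)
  simpa [mul_assoc] using this

/-- Inserting `z u` turns the cross terms into near scalars, which `star r * s = 0` kills; the
diagonal terms, already near scalars, are preserved by the isometries. -/
theorem ScalarCompression.add_mem_compressionSet (h : ScalarCompression l z φ) {r s : A}
    (hr : star r * r = 1) (hs : star s * s = 1) (hrs : star r * s = 0)
    {F : Finset A} {n : ℕ} {κ κ' : F × Fin n × Fin n → ℂ}
    (hκ : κ ∈ compressionSet F n) (hκ' : κ' ∈ compressionSet F n) :
    κ + κ' ∈ compressionSet F n := by
  intro ε hε
  have hsr : star s * r = 0 := by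
    have := congrArg star hrs
    simpa using this
  obtain ⟨x, hx⟩ := hκ (ε / 4) (by positivity)
  obtain ⟨y, hy⟩ := hκ' (ε / 4) (by positivity)
  obtain ⟨u, hu⟩ := h.exists_forall_norm_le
    (fun p : (F × Fin n × Fin n) × Bool => if p.2 then star (x p.1.2.1) * p.1.1 * y p.1.2.2
      else star (y p.1.2.1) * p.1.1 * x p.1.2.2) (ε := ε / 4) (by positivity)
  have hz := h.isometry u
  refine ⟨fun i => x i * z u * r + y i * z u * s, fun a i j => ?_⟩
  have hxx : ‖star r * (star (z u) * (star (x i) * a * x j - κ (a, i, j) • 1) * z u) * r‖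
      ≤ ε / 4 :=
    ((norm_star_mul_mul_le hr _).trans (norm_star_mul_mul_le hz _)).trans (hx a i j)
  have hyy : ‖star s * (star (z u) * (star (y i) * a * y j - κ' (a, i, j) • 1) * z u) * s‖
      ≤ ε / 4 :=
    ((norm_star_mul_mul_le hs _).trans (norm_star_mul_mul_le hz _)).trans (hy a i j)
  have hxy : ‖star r * (star (z u) * (star (x i) * a * y j) * z u -
      φ (star (x i) * a * y j) • 1) * s‖ ≤ ε / 4 :=
    (norm_star_mul_mul_le_of_isometry hr hs _).trans (by simpa using hu ((a, i, j), true))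
  have hyx : ‖star s * (star (z u) * (star (y i) * a * x j) * z u -
      φ (star (y i) * a * x j) • 1) * r‖ ≤ ε / 4 :=
    (norm_star_mul_mul_le_of_isometry hs hr _).trans (by simpa using hu ((a, i, j), false))
  have heq : star (x i * z u * r + y i * z u * s) * a * (x j * z u * r + y j * z u * s) -
      (κ + κ') (a, i, j) • 1 =
      star r * (star (z u) * (star (x i) * a * x j - κ (a, i, j) • 1) * z u) * r +
      star s * (star (z u) * (star (y i) * a * y j - κ' (a, i, j) • 1) * z u) * s +
      star r * (star (z u) * (star (x i) * a * y j) * z u - φ (star (x i) * a * y j) • 1) * s +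
      star s * (star (z u) * (star (y i) * a * x j) * z u -
        φ (star (y i) * a * x j) • 1) * r := by
    simp only [mul_sub, sub_mul, mul_smul_comm, smul_mul_assoc, mul_one, hz, hr, hs, hrs, hsr,
      smul_zero, sub_zero, Pi.add_apply, add_smul, star_add, star_mul, add_mul, mul_add, mul_assoc]
    abel
  rw [heq]
  refine (norm_add₄_le).trans ?_
  linarith

variable [PartialOrder A] [StarOrderedRing A]

/-- Completely positive maps into matrix algebras are approximately compressions. -/
theorem ScalarCompression.apply_mem_compressionSet [Nontrivial A] (hA : CStarIsSimple A)
    (h : ScalarCompression l z φ) {r s : A}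
    (hr : star r * r = 1) (hs : star s * s = 1) (hrs : star r * s = 0) (F : Finset A) {n : ℕ}
    (S : A →CP CStarMatrix (Fin n) (Fin n) ℂ) :
    (fun p => S p.1 p.2.1 p.2.2) ∈ compressionSet F n := by
  classical
  let K : ProperCone ℝ (F × Fin n × Fin n → ℂ) :=
    { carrier := compressionSet F n
      add_mem' := fun ha hb => h.add_mem_compressionSet hr hs hrs ha hb
      zero_mem' := zero_mem_compressionSet F n
      smul_mem' := fun c _ hκ => smul_mem_compressionSet hκ c.2
      isClosed' := isClosed_compressionSet F n }
  by_contra hS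
  obtain ⟨f, hf, hfS⟩ := K.hyperplane_separation_point (x₀ := fun p => S p.1 p.2.1 p.2.2) hS
  -- Complex coefficients representing the real-linear functional: `f κ = Re ∑ w p * κ p`.
  let w : F × Fin n × Fin n → ℂ := fun p =>
    (f (Pi.single p 1) : ℂ) - Complex.I * f (Pi.single p Complex.I)
  have hfw : ∀ κ, f κ = (∑ p, w p * κ p).re := by
    intro κ
    have h1 : κ = ∑ p, ((κ p).re • (Pi.single p 1 : F × Fin n × Fin n → ℂ) +
        (κ p).im • (Pi.single p Complex.I : F × Fin n × Fin n → ℂ)) := by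
      funext q
      rw [Finset.sum_apply, Finset.sum_eq_single q]
      · simp [Complex.re_add_im]
      · intro p _ hp
        simp [hp.symm]
      · simp
    nth_rw 1 [h1]
    rw [map_sum, Complex.re_sum]
    refine Finset.sum_congr rfl fun p _ => ?_
    simp [w]
    ring
  let m : Fin n → Fin n → A := fun i j => ∑ a : F, w (a, i, j) • (a : A)
  have hfm : ∀ g : Fin n → Fin n → A →ₗ[ℂ] ℂ,
      f (fun p => g p.2.1 p.2.2 p.1) = (∑ i, ∑ j, g i j (m i j)).re := by
    intro g
    rw [hfw, Fintype.sum_prod_type_right, Fintype.sum_prod_type]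
    simp [m]
  have hH : (0 : CStarMatrix (Fin n) (Fin n) A) ≤
      CStarMatrix.ofMatrix fun i j => m i j + star (m j i) := by
    refine CStarMatrix.nonneg_of_forall_sum_nonneg ?_ fun b => ?_
    · refine CStarMatrix.ext fun i j => ?_
      rw [CStarMatrix.star_apply]
      change star (m j i + star (m i j)) = m i j + star (m j i)
      simp [add_comm]
    · have hsum : ∑ i, ∑ j, star (b i) * (m i j + star (m j i)) * b j =
          (∑ i, ∑ j, star (b i) * m i j * b j) + star (∑ i, ∑ j, star (b i) * m i j * b j) := by
        simp only [mul_add, add_mul, Finset.sum_add_distrib, star_sum]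
        congr 1
        rw [Finset.sum_comm]
        simp [mul_assoc]
      change 0 ≤ ∑ i, ∑ j, star (b i) * (m i j + star (m j i)) * b j
      rw [hsum]
      refine h.nonneg_of_forall hA (IsSelfAdjoint.add_star_self _) fun c => ?_
      -- Nonnegativity of `f` on the families built from `b i * c` is exactly the hypothesis `φ`
      -- needs to detect positivity.
      have h1 := hf _ (h.map_mem_compressionSet F fun i => b i * c)
      have h2 := hfm fun i j => φ.comp
        ((LinearMap.mulRight ℂ (b j * c)).comp (LinearMap.mulLeft ℂ (star (b i * c))))
      simp only [LinearMap.comp_apply, LinearMap.mulRight_apply, LinearMap.mulLeft_apply] at h2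
      rw [h2] at h1
      simp only [← map_sum] at h1
      have h3 : ∑ i, ∑ j, star (b i * c) * m i j * (b j * c) =
          star c * (∑ i, ∑ j, star (b i) * m i j * b j) * c := by
        simp only [Finset.mul_sum, Finset.sum_mul, star_mul, mul_assoc]
      rw [h3] at h1
      set Y := ∑ i, ∑ j, star (b i) * m i j * b j
      have h4 : star c * star Y * c = star (star c * Y * c) := by simp [mul_assoc]
      rw [mul_add, add_mul, h4, map_add, h.map_star]
      simpa using h1
  have hS1 := S.re_sum_apply_nonneg hH
  have hSs : ∀ (x : A) i j, S (star x) i j = star (S x j i) := by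
    intro x i j
    rw [StarHomClass.map_star, CStarMatrix.star_apply]
  have hS2 := hfm fun i j =>
    { toFun := fun x => S x i j
      map_add' := fun x y => by rw [map_add, CStarMatrix.add_apply]
      map_smul' := fun c x => by simp }
  simp only [LinearMap.coe_mk, AddHom.coe_mk] at hS2
  -- Symmetrising doubles the real part, so complete positivity makes `2 * f(S)` nonnegative, while
  -- separation made `f(S)` negative.
  have hS3 : (∑ i, ∑ j, S ((CStarMatrix.ofMatrix fun i j => m i j + star (m j i) :
      CStarMatrix (Fin n) (Fin n) A) i j) i j).re = 2 * (∑ i, ∑ j, S (m i j) i j).re := by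
    change (∑ i, ∑ j, S (m i j + star (m j i)) i j).re = _
    simp only [map_add, CStarMatrix.add_apply, hSs, Finset.sum_add_distrib, Complex.add_re]
    rw [Finset.sum_comm (f := fun i j => star (S (m j i) j i))]
    simp [two_mul]
  rw [hS3, ← hS2] at hS1
  linarith

end Cone

/-! ### Polar correction and assembly of the isometry. -/

section Main

variable {A : Type*} [CStarAlgebra A]

/-- An element which is almost an isometry is close to an isometry, by polar decomposition. -/
theorem exists_isometry_mul_eq {x : A} {ρ : ℝ} (hρ : ρ < 1) (hx : ‖star x * x - 1‖ ≤ ρ) :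
    ∃ s h : A, star s * s = 1 ∧ x = s * h ∧ ‖h - 1‖ ≤ ρ := by
  have hρ0 : 0 ≤ ρ := (norm_nonneg _).trans hx
  set g := star x * x with hg
  have hgs : IsSelfAdjoint g := IsSelfAdjoint.star_mul_self x
  have hspec : ∀ t ∈ spectrum ℝ g, |t - 1| ≤ ρ := by
    refine (norm_cfc_le_iff (fun t : ℝ => t - 1) g hρ0).1 ?_
    rwa [cfc_sub (fun t : ℝ => t) (fun _ => 1) g, cfc_id' ℝ g, cfc_const_one ℝ g]
  have hspec0 : ∀ t ∈ spectrum ℝ g, 0 ≤ t := fun t ht => by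
    linarith [(abs_le.1 (hspec t ht)).1]
  have hsqrt : ContinuousOn Real.sqrt (spectrum ℝ g) := Real.continuous_sqrt.continuousOn
  set h := cfc Real.sqrt g with hh
  have hhs : star h = h := (cfc_predicate Real.sqrt g : IsSelfAdjoint h)
  have hhh : h * h = g := by
    rw [hh, ← cfc_mul Real.sqrt Real.sqrt g]
    nth_rw 2 [← cfc_id' ℝ g]
    exact cfc_congr fun t ht => Real.mul_self_sqrt (hspec0 t ht)
  have hh1 : ‖h - 1‖ ≤ ρ := by
    have : h - 1 = cfc (fun t : ℝ => √t - 1) g := by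
      rw [cfc_sub Real.sqrt (fun _ => 1) g, cfc_const_one ℝ g]
    rw [this]
    refine norm_cfc_le hρ0 fun t ht => ?_
    refine le_trans ?_ (hspec t ht)
    have h1 : t - 1 = (√t - 1) * (√t + 1) := by
      nlinarith [Real.mul_self_sqrt (hspec0 t ht)]
    rw [Real.norm_eq_abs, h1, abs_mul]
    refine le_mul_of_one_le_right (abs_nonneg _) ?_
    rw [abs_of_nonneg (by positivity)]
    linarith [Real.sqrt_nonneg t]
  have hu : IsUnit h := by
    have := isUnit_one_sub_of_norm_lt_one (x := 1 - h) (by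
      rw [norm_sub_rev]; exact hh1.trans_lt hρ)
    simpa using this
  obtain ⟨u, hu⟩ := hu
  have hsu : star (↑u⁻¹ : A) = ↑u⁻¹ := by
    have : star u = u := Units.ext (by rw [Units.coe_star, hu, hhs])
    rw [← Units.coe_star, star_inv, this]
  refine ⟨x * ↑u⁻¹, h, ?_, ?_, hh1⟩
  · have : star (x * ↑u⁻¹ : A) * (x * ↑u⁻¹) = ↑u⁻¹ * g * ↑u⁻¹ := by
      rw [star_mul, hsu, hg]; simp only [mul_assoc]
    rw [this, ← hhh, ← hu]
    simp
  · rw [← hu]; simp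

theorem norm_star_mul_mul_sub_le {s h : A} (hs : star s * s = 1) {ρ : ℝ} (hρ : ρ ≤ 1)
    (hh : ‖h - 1‖ ≤ ρ) (a : A) :
    ‖star s * a * s - star (s * h) * a * (s * h)‖ ≤ 3 * ρ * ‖a‖ := by
  have hs' := norm_star_mul_mul_le hs a
  have hρ0 : 0 ≤ ρ := (norm_nonneg _).trans hh
  have heq : star s * a * s - star (s * h) * a * (s * h) =
      -(star (h - 1) * (star s * a * s) * (h - 1) + star (h - 1) * (star s * a * s) +
        (star s * a * s) * (h - 1)) := by
    simp only [star_mul, star_sub, star_one]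
    noncomm_ring
  set b := star s * a * s
  rw [heq, norm_neg]
  have h1 : ‖star (h - 1) * b * (h - 1)‖ ≤ ρ * ‖a‖ * 1 := by
    refine norm_mul₃_le.trans ?_
    rw [norm_star]
    gcongr
    exact hh.trans hρ
  have h2 : ‖star (h - 1) * b‖ ≤ ρ * ‖a‖ := by
    refine (norm_mul_le _ _).trans ?_
    rw [norm_star]
    gcongr
  have h3 : ‖b * (h - 1)‖ ≤ ‖a‖ * ρ := by
    refine (norm_mul_le _ _).trans ?_
    gcongr
  refine (norm_add₃_le).trans ?_
  linarith

theorem norm_sum_sum_mul_mul_le {n : ℕ} (W : Fin n → A) (d : Fin n → Fin n → A) {η : ℝ}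
    (hd : ∀ i j, ‖d i j‖ ≤ η) :
    ‖∑ i, ∑ j, star (W i) * d i j * W j‖ ≤ η * (∑ i, ‖W i‖) ^ 2 := by
  calc ‖∑ i, ∑ j, star (W i) * d i j * W j‖ ≤ ∑ i, ∑ j, ‖W i‖ * η * ‖W j‖ := by
        refine norm_sum_le_of_le _ fun i _ => norm_sum_le_of_le _ fun j _ => ?_
        refine norm_mul₃_le.trans ?_
        rw [norm_star]
        gcongr
        exact hd i j
    _ = η * (∑ i, ‖W i‖) ^ 2 := by
      rw [sq, Finset.sum_mul_sum, Finset.mul_sum]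
      refine Finset.sum_congr rfl fun i _ => ?_
      rw [Finset.mul_sum]
      exact Finset.sum_congr rfl fun j _ => by ring

variable [PartialOrder A] [StarOrderedRing A]

/-- Approximate compressions representing `S`, combined with a Choi decomposition of `T` and
isometries with orthogonal ranges, give a nonunitary isometry implementing `T ∘ S`. -/
theorem exists_nonunitary_isometry_of_factorization (hA : IsPurelyInfiniteSimple A) {n : ℕ}
    (S : A →CP CStarMatrix (Fin n) (Fin n) ℂ) (T : CStarMatrix (Fin n) (Fin n) ℂ →CP A)
    (hS : S 1 = 1) (hT : T 1 = 1) {ε : ℝ} (hε : 0 < ε) (F : Finset A) :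
    ∃ s : A, star s * s = 1 ∧ s ∉ unitary A ∧ ∀ a ∈ F, ‖star s * a * s - T (S a)‖ ≤ ε := by
  classical
  have : Nontrivial A := hA.isSimple.nontrivial
  have hn : NeZero n := by
    refine ⟨?_⟩
    rintro rfl
    have h0 : (1 : CStarMatrix (Fin 0) (Fin 0) ℂ) = 0 :=
      CStarMatrix.ext fun i => i.elim0
    rw [h0, map_zero] at hT
    exact zero_ne_one hT
  obtain ⟨l, z, φ, hφ⟩ := hA.exists_scalarCompression
  obtain ⟨q, hq, -⟩ := hA.exists_infinite_compression_finset ∅ one_pos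
  obtain ⟨r, hr, -⟩ := hq.exists_isometries hA.isSimple
  have hr1 : ∀ k, star (r k) * r k = 1 := fun k => by simpa using hr k k
  have hr0 : ∀ k m, k ≠ m → star (r k) * r m = 0 := fun k m hkm => by simpa [hkm] using hr k m
  obtain ⟨c, hc⟩ := T.exists_apply_eq_sum
  let W : Fin n → A := fun i => ∑ k : Fin n, r k * c k i
  have hW : ∀ i j, star (W i) * W j = ∑ k, star (c k i) * c k j := by
    intro i j
    have : star (W i) * W j = ∑ k : Fin n, ∑ m : Fin n,
        star (c k i) * (star (r k) * r m) * c m j := by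
      simp only [W, star_sum, star_mul, Finset.sum_mul_sum, mul_assoc]
    rw [this]
    simp only [hr, Fin.val_inj]
    simp
  -- The `W j` use only `r 0, …, r (n - 1)`; `r n` is kept spare to witness nonunitarity.
  have hrW : ∀ j, star (r n) * W j = 0 := by
    intro j
    simp only [W, Finset.mul_sum, ← mul_assoc]
    exact Finset.sum_eq_zero fun k _ => by rw [hr0 n k k.2.ne', zero_mul]
  set D := ∑ i, ‖W i‖ with hD
  have hD0 : 0 ≤ D := Finset.sum_nonneg fun i _ => norm_nonneg _
  set B := 1 + ∑ a ∈ F, ‖a‖ with hB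
  have hB1 : 1 ≤ B := le_add_of_nonneg_right (Finset.sum_nonneg fun a _ => norm_nonneg a)
  have hBa : ∀ a ∈ F, ‖a‖ ≤ B := fun a ha =>
    (Finset.single_le_sum (f := fun a : A => ‖a‖) (fun b _ => norm_nonneg b) ha).trans
      (le_add_of_nonneg_left zero_le_one)
  -- The final error is at most `3 * θ * B + θ ≤ 4 * θ * B ≤ ε / 4`; `η` below is chosen so that
  -- `η`, `η * D` and `η * D ^ 2` sum to `θ`.
  set θ := min 1 ε / (16 * B) with hθ
  have hθ0 : 0 < θ := by positivity
  have hθB : θ * B * 16 = min 1 ε := by rw [hθ]; field_simp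
  have hθ1 : θ ≤ 1 / 16 := by nlinarith [min_le_left 1 ε]
  set η := θ / (1 + D + D ^ 2) with hη
  have hη0 : 0 < η := by positivity
  have hηθ : η + η * D + η * D ^ 2 = θ := by rw [hη]; field_simp
  have hηD : 0 ≤ η * D := by positivity
  have hηD2 : 0 ≤ η * D ^ 2 := by positivity
  obtain ⟨x, hx⟩ := hφ.apply_mem_compressionSet hA.isSimple (hr1 0) (hr1 1)
    (hr0 0 1 zero_ne_one) (insert 1 F) S η hη0
  set s₀ := ∑ i, x i * W i with hs₀
  have hs₀a : ∀ a ∈ insert 1 F, ‖star s₀ * a * s₀ - T (S a)‖ ≤ η * D ^ 2 := by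
    intro a ha
    have h1 : star s₀ * a * s₀ - T (S a) =
        ∑ i, ∑ j, star (W i) * (star (x i) * a * x j - S a i j • 1) * W j := by
      have h2 : star s₀ * a * s₀ = ∑ i, ∑ j, star (W i) * (star (x i) * a * x j) * W j := by
        simp only [hs₀, star_sum, star_mul, Finset.sum_mul, Finset.mul_sum, mul_assoc]
        rw [Finset.sum_comm]
      rw [h2, hc, ← Finset.sum_sub_distrib]
      refine Finset.sum_congr rfl fun i _ => ?_
      rw [← Finset.sum_sub_distrib]
      refine Finset.sum_congr rfl fun j _ => ?_
      rw [mul_sub, sub_mul, ← hW]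
      simp
    rw [h1]
    exact norm_sum_sum_mul_mul_le W _ fun i j => hx ⟨a, ha⟩ i j
  have hx1 : ∀ i j, ‖star (x i) * x j - (1 : CStarMatrix (Fin n) (Fin n) ℂ) i j • 1‖ ≤ η := by
    intro i j
    have := hx ⟨1, Finset.mem_insert_self 1 F⟩ i j
    simpa [hS] using this
  have hs₀1 : ‖star s₀ * s₀ - 1‖ ≤ η * D ^ 2 := by
    have := hs₀a 1 (Finset.mem_insert_self 1 F)
    rwa [hS, hT, mul_one] at this
  obtain ⟨s, h, hs, hsh, hh⟩ := exists_isometry_mul_eq (by linarith) hs₀1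
  refine ⟨s, hs, fun hsu => ?_, fun a ha => ?_⟩
  · have hss : s * star s = 1 := Unitary.mul_star_self_of_mem hsu
    -- `s'` is nearly an isometry and nearly orthogonal to `s₀`, hence to `s`. Were `s` unitary,
    -- `‖s'‖ = ‖star s' * s‖` would be at most `1 / 2`, contradicting `‖s'‖² ≥ 1 - η`.
    set s' := x 0 * r n with hs'
    have h1 : ‖star s' * s' - 1‖ ≤ η := by
      have h2 : star s' * s' - 1 = star (r n) * (star (x 0) * x 0 - 1) * r n := by
        rw [mul_sub, sub_mul, mul_one, hr1]; simp [hs', mul_assoc]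
      rw [h2]
      exact (norm_star_mul_mul_le (hr1 n) _).trans (by simpa using hx1 0 0)
    have h2 : ‖star s' * s₀‖ ≤ η * D := by
      have h3 : star s' * s₀ = ∑ j, star (r n) *
          (star (x 0) * x j - (1 : CStarMatrix (Fin n) (Fin n) ℂ) 0 j • 1) * W j := by
        rw [hs₀, Finset.mul_sum]
        refine Finset.sum_congr rfl fun j _ => ?_
        rw [mul_sub, sub_mul]
        simp [hs', mul_assoc, hrW]
      rw [h3, hD, Finset.mul_sum]
      refine norm_sum_le_of_le _ fun j _ => norm_mul₃_le.trans ?_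
      have h4 := norm_le_one_of_star_mul_self_eq_one (hr1 n)
      rw [norm_star]
      calc _ ≤ 1 * η * ‖W j‖ := by gcongr; exact hx1 0 j
        _ = η * ‖W j‖ := by ring
    have h3 : ‖star s' * s‖ ≤ η * D + ‖star s' * s‖ * (η * D ^ 2) := by
      have h4 : star s' * s = star s' * s₀ - star s' * s * (h - 1) := by
        rw [hsh]; noncomm_ring
      calc ‖star s' * s‖ = ‖star s' * s₀ - star s' * s * (h - 1)‖ := by rw [← h4]
        _ ≤ ‖star s' * s₀‖ + ‖star s' * s * (h - 1)‖ := norm_sub_le _ _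
        _ ≤ _ := by
          gcongr
          refine (norm_mul_le _ _).trans ?_
          gcongr
    have h5 : ‖s'‖ = ‖star s' * s‖ := by
      have h6 := CStarRing.norm_self_mul_star (x := star s' * s)
      have h7 : star s' * s * star (star s' * s) = star s' * s' := by
        have : star s' * s * star (star s' * s) = star s' * (s * star s) * s' := by
          simp [mul_assoc]
        rw [this, hss, mul_one]
      rw [h7, CStarRing.norm_star_mul_self] at h6
      exact (mul_self_inj (norm_nonneg _) (norm_nonneg _)).1 h6
    have h8 : 1 - η ≤ ‖s'‖ * ‖s'‖ := by
      rw [← CStarRing.norm_star_mul_self]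
      have := norm_sub_norm_le (1 : A) (star s' * s')
      rw [CStarRing.norm_one, norm_sub_rev] at this
      linarith
    rw [← h5] at h3
    have h9 : ‖s'‖ ≤ 1 / 2 := by
      have : ‖s'‖ * (η * D ^ 2) ≤ ‖s'‖ * (1 / 2) := by gcongr; linarith
      linarith
    nlinarith [norm_nonneg s']
  · have h1 := norm_star_mul_mul_sub_le hs (by linarith : η * D ^ 2 ≤ 1) hh a
    rw [← hsh] at h1
    have h2 := hs₀a a (Finset.mem_insert_of_mem ha)
    have h3 : η * D ^ 2 ≤ θ := by linarith
    have h4 : 3 * (η * D ^ 2) * ‖a‖ ≤ 3 * θ * B := by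
      gcongr
      exact hBa a ha
    have h5 : θ ≤ θ * B := le_mul_of_one_le_right hθ0.le hB1
    calc ‖star s * a * s - T (S a)‖ ≤ ‖star s * a * s - star s₀ * a * s₀‖ +
          ‖star s₀ * a * s₀ - T (S a)‖ := norm_sub_le_norm_sub_add_norm_sub _ _ _
      _ ≤ ε := by linarith [min_le_right 1 ε]

end Main

theorem proposition1p7 {A : Type*} [CStarAlgebra A] [PartialOrder A] [StarOrderedRing A]
    (hA : IsPurelyInfiniteSimple A) (V : A →CP A) (hV1 : V 1 = 1) (hV : IsNuclearUCP V)
    (ε : ℝ) (hε : 0 < ε) (F : Finset A) :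
    ∃ s : A, star s * s = 1 ∧ s ∉ unitary A ∧ ∀ a ∈ F, ‖star s * a * s - V a‖ < ε := by
  obtain ⟨n, S, T, hS, hT, hST⟩ := hV F (ε / 2) (half_pos hε)
  obtain ⟨s, hs, hsu, hsF⟩ :=
    exists_nonunitary_isometry_of_factorization hA S T hS hT (half_pos hε) F
  refine ⟨s, hs, hsu, fun a ha => ?_⟩
  calc ‖star s * a * s - V a‖ ≤ ‖star s * a * s - T (S a)‖ + ‖T (S a) - V a‖ :=
        norm_sub_le_norm_sub_add_norm_sub _ _ _
    _ < ε := by linarith [hsF a ha, hST a ha]
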